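/- Let $m\ge 0$ be an integer, write $[m]=\{1,\dots,m\}$, and let $W(1),W(2),\dots$ be independent random $m\times m$ matrices on a probability space, with measurable entries, each of which is almost surely row-stochastic. Assume that the chain $\{W(k)\}$ is * *strongly aperiodic*: there is $\gamma\in(0,1]$ with $\mathbb E[W_{ii}(k)W_{ij}(k)]\ge\gamma\,\mathbb E[W_{ij}(k)]$ for all $i\neq j$ in $[m]$ and all $k\ge1$; * *balanced*: there is $\alpha>0$ with $\mathbb E\big[\sum_{i\in S,\,j\notin S}W_{ij}(k)\big]\ge\alpha\,\mathbb E\big[\sum_{i\notin S,\,j\in S}W_{ij}(k)\big]$ for all $S\subset[m]$ with $S\ne\emptyset$, $S\neq[m]$, and all $k\ge1$. The *infinite flow graph* of a chain $\{A(k)\}_{k\ge1}$ of matrices is the graph on $[m]$ in which distinct $i,j$ are joined if and only if $\sum_{k\ge1}(A_{ij}(k)+A_{ji}(k))=\infty$; for the random chain $\{W(k)\}$ it is formed for each sample path. For $k\ge t_0\ge0$ put $W(k:t_0)=W(k)W(k-1)\cdots W(t_0+1)$, with $W(t_0:t_0)=I$. 1. If the infinite flow graph of $\{W(k)\}$ is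 almost surely connected, then for every $t_0\ge0$ the product $W(k:t_0)$ converges almost surely, as $k\to\infty$, to a (random) row-stochastic matrix of rank one. 2. In general (in particular, if the infinite flow graph of $\{W(k)\}$ is not almost surely connected), for every $t_0\ge0$ the product $W(k:t_0)$ converges almost surely, as $k\to\infty$, to a (random) matrix of rank at most $\tau$, where $\tau$ is the number of connected components of the infinite flow graph of the expected chain $\{\mathbb E[W(k)]\}$. -/

import Mathlib

open MeasureTheory ProbabilityTheory Filter Topology

namespace StochasticChain

/-- The product `A(k:t₀) = A(k) ⋯ A(t₀+1)` for `k > t₀`, with `A(t₀:t₀) = I`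
(and, as a harmless convention, `I` for `k < t₀`). -/
def prod {m : ℕ} (A : ℕ → Matrix (Fin m) (Fin m) ℝ) : ℕ → ℕ → Matrix (Fin m) (Fin m) ℝ
  | 0, _ => 1
  | k + 1, t₀ => if t₀ ≤ k then A (k + 1) * prod A k t₀ else 1

/-- The infinite flow graph of a deterministic chain `A(1), A(2), …`: distinct vertices `i`, `j`
are joined iff `∑_{k ≥ 1} (A_{ij}(k) + A_{ji}(k)) = ∞`. For a random chain, this is applied to
each sample path. -/
def flowGraph {m : ℕ} (A : ℕ → Matrix (Fin m) (Fin m) ℝ) : SimpleGraph (Fin m) where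
  Adj i j := i ≠ j ∧
    Tendsto (fun n : ℕ => ∑ k ∈ Finset.Icc 1 n, (A k i j + A k j i)) atTop atTop
  symm := ⟨fun i j h => ⟨h.1.symm, by simpa only [add_comm] using h.2⟩⟩
  loopless := ⟨fun _ h => h.1 rfl⟩

/-- The expected chain `k ↦ E[W(k)]` (entrywise expectation). -/
noncomputable def expected {m : ℕ} {Ω : Type*} [MeasurableSpace Ω] (μ : Measure Ω)
    (W : ℕ → Ω → Matrix (Fin m) (Fin m) ℝ) : ℕ → Matrix (Fin m) (Fin m) ℝ :=
  fun k => Matrix.of fun i j => ∫ ω, W k ω i j ∂μ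

/-- `W(1), W(2), …` is an independent chain of random (row-)stochastic matrices. The matrix
`W 0` plays no role. -/
structure IsIndependentChain {m : ℕ} {Ω : Type*} [MeasurableSpace Ω] (μ : Measure Ω)
    (W : ℕ → Ω → Matrix (Fin m) (Fin m) ℝ) : Prop where
  measurable : ∀ k, 1 ≤ k → ∀ i j, Measurable fun ω => W k ω i j
  stochastic : ∀ k, 1 ≤ k → ∀ᵐ ω ∂μ, W k ω ∈ Matrix.rowStochastic ℝ (Fin m)
  indep : iIndepFun (fun (k : ℕ) (ω : Ω) (i j : Fin m) => W (k + 1) ω i j) μ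

/-- Strong aperiodicity: `E[W_{ii}(k) W_{ij}(k)] ≥ γ E[W_{ij}(k)]` for some `γ ∈ (0,1]`, all
`i ≠ j` and all `k ≥ 1`. -/
def StronglyAperiodic {m : ℕ} {Ω : Type*} [MeasurableSpace Ω] (μ : Measure Ω)
    (W : ℕ → Ω → Matrix (Fin m) (Fin m) ℝ) : Prop :=
  ∃ γ : ℝ, 0 < γ ∧ γ ≤ 1 ∧ ∀ k, 1 ≤ k → ∀ i j : Fin m, i ≠ j →
    γ * ∫ ω, W k ω i j ∂μ ≤ ∫ ω, W k ω i i * W k ω i j ∂μ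

/-- The flow `M_{S S̄} = ∑_{i ∈ S, j ∉ S} M_{ij}` out of an index set `S`. -/
def cutFlow {m : ℕ} (M : Matrix (Fin m) (Fin m) ℝ) (S : Finset (Fin m)) : ℝ :=
  ∑ i ∈ S, ∑ j ∈ Sᶜ, M i j

/-- Balancedness: `E[W_{S S̄}(k)] ≥ α E[W_{S̄ S}(k)]` for some `α > 0`, all nontrivial `S` and
all `k ≥ 1`. -/
def Balanced {m : ℕ} {Ω : Type*} [MeasurableSpace Ω] (μ : Measure Ω)
    (W : ℕ → Ω → Matrix (Fin m) (Fin m) ℝ) : Prop :=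
  ∃ α : ℝ, 0 < α ∧ ∀ k, 1 ≤ k → ∀ S : Finset (Fin m), S.Nonempty → S ≠ Finset.univ →
    α * ∫ ω, cutFlow (W k ω) Sᶜ ∂μ ≤ ∫ ω, cutFlow (W k ω) S ∂μ

end StochasticChain

/-!
Let `A(n) = E[W(n)]` be the expected chain. Strong aperiodicity bounds its diagonals below, and
together with balancedness this bounds the column sums of all products `A(N) ⋯ A(n)` below by some
`p > 0` (`exists_le_sum_backProd`): for `R` large, the minimum over permutations `σ` of
`∑ i, R ^ σ i * x i` does not decrease under `x ↦ A(n) x`. A limit of these column sums gives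
weights `π_i(n) ≥ p` with `π(n) = π(n+1) A(n)` (`exists_absolute_weights`).

Let `x(n+1) = W(n) x(n)` be a column of the random product. For every convex `g`, independence,
Jensen's inequality and the equation for `π` make `∑ i, π_i(n) g(x_i(n))` a bounded supermartingale.

* With `g = |· - c|` for rational `c`, it follows that almost surely `∑ i, π_i(n) |x_i(n) - c|`
  converges for all rational `c`.
* With `g` the square, the drop in expectation dominates `∑ i l, E[W_il(n)] E[(x_i(n) - x_l(n))²]`
  up to a constant, by strong aperiodicity. Hence almost surely both `E[W_il(n)] (x_i(n) - x_l(n))²`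
  and `W_il(n) (x_i(n) - x_l(n))²` are summable over `n`.

The second summability forces the increments `x_i(n+1) - x_i(n)` to zero, so the cluster points of
`x_i` form an interval. The first item forces the cluster points of all `m` coordinates together to
be at most `m` in number, as each coordinate carries weight at least `p`. So every `x_i` converges
(`exists_tendsto_of_weighted_abs`). If `∑ n, E[W_il(n)] = ∞`, the first summability shows that the
limits of `x_i` and `x_l` agree (`ae_tendsto_traj`). The rows of the limit matrix therefore agree
along the components of the flow graph of the expected chain, which bounds its rank. If the sample
flow graph is almost surely connected, then so is that of the expected chain, which almost surely
contains it (`IsIndependentChain.ae_flowGraph_le`).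
-/

namespace StochasticChain

/-! ### Column sums of backward products of a balanced chain -/

/-- Abel summation: nonnegative prefix sums pair nonnegatively with an antitone sequence. -/
theorem sum_mul_nonneg_of_antitone {m : ℕ} {v y : Fin m → ℝ} (hy : Antitone y)
    (hv : ∀ l ≤ m, 0 ≤ ∑ i : Fin m with i.val < l, v i) (htot : ∑ i, v i = 0) :
    0 ≤ ∑ i, v i * y i := by
  have key : ∀ l (hl : l < m), (∑ i : Fin m with i.val < l + 1, v i) * y ⟨l, hl⟩ ≤
      ∑ i : Fin m with i.val < l + 1, v i * y i := by
    have hins : ∀ l (hl : l < m), (Finset.univ.filter fun i : Fin m => i.val < l + 1) =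
        insert ⟨l, hl⟩ (Finset.univ.filter fun i : Fin m => i.val < l) := by
      intro l hl
      ext i
      simp [Fin.ext_iff]
      omega
    intro l
    induction l with
    | zero =>
      intro hl
      rw [hins 0 hl]
      simp
    | succ l ih =>
      intro hl
      have h1 := ih (by omega)
      have h2 : y ⟨l + 1, hl⟩ ≤ y ⟨l, by omega⟩ := hy (by simp [Fin.le_def])
      rw [hins (l + 1) hl, Finset.sum_insert (by simp), Finset.sum_insert (by simp), add_mul]
      have h3 := mul_le_mul_of_nonneg_left h2 (hv (l + 1) (by omega))
      linarith
  rcases m with _ | k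
  · simp
  · have h := key k (by omega)
    have hall : (Finset.univ.filter fun i : Fin (k + 1) => i.val < k + 1) = Finset.univ := by
      ext i
      simpa using Nat.lt_succ_iff.1 i.2
    rwa [hall, htot, zero_mul] at h

/-- The case of an indicator vector `x = 1_S` in `le_sum_pow_mul_mulVec`. If `σ` gives the
elements of `S` the smallest weights, balancedness makes the gain outside `S` outweigh the loss
inside `S`; otherwise a single diagonal entry in `S` carries enough weight. -/
theorem geom_sum_card_le {m : ℕ} {A : Matrix (Fin m) (Fin m) ℝ} {δ α R : ℝ}
    (hA : A ∈ Matrix.rowStochastic ℝ (Fin m)) (hδ : ∀ i, δ ≤ A i i) (hδ0 : 0 ≤ δ)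
    (hbal : ∀ S : Finset (Fin m), S.Nonempty → S ≠ Finset.univ →
      α * cutFlow A Sᶜ ≤ cutFlow A S)
    (hR : 1 ≤ R) (hRδ : 1 ≤ δ * (R - 1)) (hRα : 1 ≤ α * R)
    (S : Finset (Fin m)) (σ : Equiv.Perm (Fin m)) :
    ∑ k ∈ Finset.range S.card, R ^ k ≤ ∑ i, R ^ (σ i : ℕ) * ∑ j ∈ S, A i j := by
  have hnn : ∀ i j, 0 ≤ A i j := fun i j => Matrix.nonneg_of_mem_rowStochastic hA
  have hR0 : 0 < R := by linarith
  have hpow : ∀ n : ℕ, 0 < R ^ n := fun n => pow_pos hR0 n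
  have hterm : ∀ i, 0 ≤ R ^ (σ i : ℕ) * ∑ j ∈ S, A i j := fun i =>
    mul_nonneg (hpow _).le (Finset.sum_nonneg fun j _ => hnn i j)
  by_cases hσ : ∃ i ∈ S, S.card ≤ (σ i : ℕ)
  · obtain ⟨i, hiS, hi⟩ := hσ
    have h1 : δ ≤ ∑ j ∈ S, A i j :=
      (hδ i).trans (Finset.single_le_sum (f := fun j => A i j) (fun j _ => hnn i j) hiS)
    have h2 : R ^ S.card * δ ≤ R ^ (σ i : ℕ) * ∑ j ∈ S, A i j :=
      mul_le_mul (pow_le_pow_right₀ hR hi) h1 hδ0 (hpow _).le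
    have h3 := Finset.single_le_sum (fun i _ => hterm i) (Finset.mem_univ i)
    have h4 := geom_sum_mul R S.card
    have h5 : 0 ≤ ∑ k ∈ Finset.range S.card, R ^ k :=
      Finset.sum_nonneg fun k _ => (hpow k).le
    have h6 : ∑ k ∈ Finset.range S.card, R ^ k ≤ δ * (R ^ S.card - 1) := by
      rw [← h4]
      nlinarith
    calc _ ≤ δ * (R ^ S.card - 1) := h6
      _ ≤ R ^ S.card * δ := by nlinarith
      _ ≤ _ := h2.trans h3
  · push Not at hσ
    -- here `σ` maps `S` onto the first `S.card` indices
    have himg : (S.image fun i => (σ i : ℕ)) = Finset.range S.card := by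
      refine Finset.eq_of_subset_of_card_le ?_ ?_
      · intro k hk
        obtain ⟨i, hi, rfl⟩ := Finset.mem_image.1 hk
        exact Finset.mem_range.2 (hσ i hi)
      · have hinj : Function.Injective fun i => (σ i : ℕ) := Fin.val_injective.comp σ.injective
        rw [Finset.card_image_of_injective _ hinj, Finset.card_range]
    have hout : ∀ i ∉ S, S.card ≤ (σ i : ℕ) := by
      intro i hi
      by_contra h
      have : (σ i : ℕ) ∈ S.image fun i => (σ i : ℕ) := by
        rw [himg]
        exact Finset.mem_range.2 (not_le.1 h)
      obtain ⟨j, hj, hji⟩ := Finset.mem_image.1 this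
      exact hi (σ.injective (Fin.ext hji) ▸ hj)
    have hsum : ∑ k ∈ Finset.range S.card, R ^ k = ∑ i ∈ S, R ^ (σ i : ℕ) := by
      rw [← himg, Finset.sum_image fun i _ j _ h => σ.injective (Fin.ext h)]
    have hrow : ∀ i, ∑ j ∈ S, A i j = 1 - ∑ j ∈ Sᶜ, A i j := by
      intro i
      have := Matrix.sum_row_of_mem_rowStochastic hA i
      rw [← Finset.sum_add_sum_compl S] at this
      linarith
    have hflow : α * cutFlow A S ≤ cutFlow A Sᶜ := by
      rcases S.eq_empty_or_nonempty with rfl | hne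
      · simp [cutFlow]
      by_cases hu : S = Finset.univ
      · simp [hu, cutFlow]
      have := hbal Sᶜ (by rwa [Finset.nonempty_iff_ne_empty, Ne, Finset.compl_eq_empty_iff])
        (by rw [Ne, Finset.compl_eq_univ_iff]; exact hne.ne_empty)
      rwa [compl_compl] at this
    have hloss : ∑ i ∈ S, R ^ (σ i : ℕ) * ∑ j ∈ Sᶜ, A i j ≤ R ^ S.card * (α * cutFlow A S) := by
      unfold cutFlow
      rw [Finset.mul_sum, Finset.mul_sum]
      refine Finset.sum_le_sum fun i hi => ?_
      rw [← mul_assoc]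
      refine mul_le_mul_of_nonneg_right ?_ (Finset.sum_nonneg fun j _ => hnn i j)
      have h1 : R ^ ((σ i : ℕ) + 1) ≤ R ^ S.card := pow_le_pow_right₀ hR (hσ i hi)
      rw [pow_succ] at h1
      have hα : 0 ≤ α := by
        by_contra h
        nlinarith [not_le.1 h]
      nlinarith [hpow (σ i : ℕ), mul_le_mul_of_nonneg_left h1 hα]
    have hgain : R ^ S.card * cutFlow A Sᶜ ≤ ∑ i ∈ Sᶜ, R ^ (σ i : ℕ) * ∑ j ∈ S, A i j := by
      unfold cutFlow
      rw [compl_compl, Finset.mul_sum]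
      refine Finset.sum_le_sum fun i hi => ?_
      exact mul_le_mul_of_nonneg_right
        (pow_le_pow_right₀ hR (hout i (Finset.mem_compl.1 hi)))
        (Finset.sum_nonneg fun j _ => hnn i j)
    rw [← Finset.sum_add_sum_compl S, hsum]
    have hin : ∑ i ∈ S, R ^ (σ i : ℕ) * ∑ j ∈ S, A i j =
        ∑ i ∈ S, R ^ (σ i : ℕ) - ∑ i ∈ S, R ^ (σ i : ℕ) * ∑ j ∈ Sᶜ, A i j := by
      rw [← Finset.sum_sub_distrib]
      refine Finset.sum_congr rfl fun i _ => ?_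
      rw [hrow i]
      ring
    rw [hin]
    have := mul_le_mul_of_nonneg_left hflow (hpow S.card).le
    linarith

/-- The minimum over all permutations `σ` of `∑ i, R ^ σ i * x i`, in which the largest entries
of `x` get the smallest weights, does not decrease under `x ↦ A x`. This functional of `x` is
superadditive, and `x` is a combination of indicator vectors of its upper level sets, so that the
case of an indicator vector suffices. -/
theorem le_sum_pow_mul_mulVec {m : ℕ} {A : Matrix (Fin m) (Fin m) ℝ} {δ α R : ℝ}
    (hA : A ∈ Matrix.rowStochastic ℝ (Fin m)) (hδ : ∀ i, δ ≤ A i i) (hδ0 : 0 ≤ δ)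
    (hbal : ∀ S : Finset (Fin m), S.Nonempty → S ≠ Finset.univ →
      α * cutFlow A Sᶜ ≤ cutFlow A S)
    (hR : 1 ≤ R) (hRδ : 1 ≤ δ * (R - 1)) (hRα : 1 ≤ α * R) {x : Fin m → ℝ} {t : ℝ}
    (h : ∀ σ : Equiv.Perm (Fin m), t ≤ ∑ i, R ^ (σ i : ℕ) * x i) (σ : Equiv.Perm (Fin m)) :
    t ≤ ∑ i, R ^ (σ i : ℕ) * A.mulVec x i := by
  -- `s` lists the coordinates of `x` in decreasing order; its inverse is the minimizing permutation
  set s : Equiv.Perm (Fin m) := Tuple.sort (fun i => -x i) with hs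
  have hanti : Antitone fun k => x (s k) := by
    intro a b hab
    have := Tuple.monotone_sort (fun i => -x i) hab
    simpa using this
  set w : Fin m → ℝ := fun j => ∑ i, R ^ (σ i : ℕ) * A i j with hw
  have hprefix : ∀ S : Finset (Fin m), ∑ j ∈ S, w j = ∑ i, R ^ (σ i : ℕ) * ∑ j ∈ S, A i j := by
    intro S
    simp only [hw, Finset.mul_sum]
    exact Finset.sum_comm
  have hpos := sum_mul_nonneg_of_antitone (v := fun k => w (s k) - R ^ (k : ℕ)) hanti (by
    intro l hl
    have hcard : ((Finset.univ.filter fun i : Fin m => i.val < l).map s.toEmbedding).card = l := by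
      rw [Finset.card_map, Fin.card_filter_val_lt, min_eq_right hl]
    have h1 := geom_sum_card_le hA hδ hδ0 hbal hR hRδ hRα
      ((Finset.univ.filter fun i : Fin m => i.val < l).map s.toEmbedding) σ
    rw [← hprefix, hcard, Finset.sum_map] at h1
    have h2 : ∑ i : Fin m with i.val < l, R ^ (i : ℕ) = ∑ k ∈ Finset.range l, R ^ k := by
      refine Finset.sum_bij (fun i _ => (i : ℕ)) (by simp) (by simp [Fin.ext_iff]) ?_ (by simp)
      intro b hb
      have hb' := Finset.mem_range.1 hb
      exact ⟨⟨b, by omega⟩, by simpa using hb', rfl⟩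
    rw [Finset.sum_sub_distrib, h2]
    simpa using h1) (by
    rw [Finset.sum_sub_distrib, Equiv.sum_comp s w, hprefix]
    simp only [Matrix.sum_row_of_mem_rowStochastic hA, mul_one]
    rw [Equiv.sum_comp σ (fun k : Fin m => R ^ (k : ℕ)), sub_self])
  simp only [sub_mul, Finset.sum_sub_distrib] at hpos
  have h1 : ∑ k, w (s k) * x (s k) = ∑ i, R ^ (σ i : ℕ) * A.mulVec x i := by
    rw [Equiv.sum_comp s (fun j => w j * x j)]
    simp only [hw, Matrix.mulVec, dotProduct, Finset.mul_sum, Finset.sum_mul]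
    rw [Finset.sum_comm]
    simp only [mul_assoc]
  have h2 := h s.symm
  rw [← Equiv.sum_comp s] at h2
  simp only [Equiv.symm_apply_apply] at h2
  linarith

/-- The product `A(n+r-1) ⋯ A(n)` of the `r` matrices from time `n` on. -/
def backProd {m : ℕ} (A : ℕ → Matrix (Fin m) (Fin m) ℝ) : ℕ → ℕ → Matrix (Fin m) (Fin m) ℝ
  | _, 0 => 1
  | n, r + 1 => backProd A (n + 1) r * A n

theorem backProd_mem_rowStochastic {m : ℕ} {A : ℕ → Matrix (Fin m) (Fin m) ℝ}
    (hA : ∀ n, A n ∈ Matrix.rowStochastic ℝ (Fin m)) (n r : ℕ) :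
    backProd A n r ∈ Matrix.rowStochastic ℝ (Fin m) := by
  induction r generalizing n with
  | zero => exact one_mem _
  | succ r ih => exact mul_mem (ih _) (hA n)

/-- The column sums of all products of a balanced chain with diagonals bounded below are
bounded below. -/
theorem exists_le_sum_backProd {m : ℕ} {A : ℕ → Matrix (Fin m) (Fin m) ℝ} {δ α : ℝ}
    (hA : ∀ n, A n ∈ Matrix.rowStochastic ℝ (Fin m)) (hδ0 : 0 < δ) (hδ : ∀ n i, δ ≤ A n i i)
    (hα : 0 < α) (hbal : ∀ n, ∀ S : Finset (Fin m), S.Nonempty → S ≠ Finset.univ →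
      α * cutFlow (A n) Sᶜ ≤ cutFlow (A n) S) :
    ∃ p : ℝ, 0 < p ∧ ∀ n r j, p ≤ ∑ i, backProd A n r i j := by
  set R : ℝ := 1 + 1 / δ + 1 / α with hRdef
  have hδ1 : 0 < 1 / δ := by positivity
  have hα1 : 0 < 1 / α := by positivity
  have hR : 1 ≤ R := by linarith
  have hRδ : 1 ≤ δ * (R - 1) := by
    have : δ * (R - 1) = 1 + δ * (1 / α) := by
      rw [hRdef]
      field_simp
      ring
    rw [this]
    linarith [mul_pos hδ0 hα1]
  have hRα : 1 ≤ α * R := by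
    have : α * R = α + α * (1 / δ) + 1 := by
      rw [hRdef]
      field_simp
    rw [this]
    linarith [mul_pos hα hδ1]
  have hinv : ∀ r n (x : Fin m → ℝ) (t : ℝ),
      (∀ σ : Equiv.Perm (Fin m), t ≤ ∑ i, R ^ (σ i : ℕ) * x i) →
      ∀ σ : Equiv.Perm (Fin m), t ≤ ∑ i, R ^ (σ i : ℕ) * (backProd A n r).mulVec x i := by
    intro r
    induction r with
    | zero => intro n x t h σ; simpa [backProd] using h σ
    | succ r ih =>
      intro n x t h σ
      have := ih (n + 1) ((A n).mulVec x) t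
        (le_sum_pow_mul_mulVec (hA n) (hδ n) hδ0.le (hbal n) hR hRδ hRα h) σ
      simpa [backProd, Matrix.mulVec_mulVec] using this
  have hRm : 0 < R ^ m := pow_pos (by linarith) m
  refine ⟨(R ^ m)⁻¹, inv_pos.2 hRm, fun n r j => ?_⟩
  -- every `σ` gives the `j`-th unit vector the value `R ^ σ j ≥ 1`
  have h1 := hinv r n (Pi.single j 1) 1 (by
    intro σ
    simp only [Pi.single_apply, mul_ite, mul_one, mul_zero, Finset.sum_ite_eq',
      Finset.mem_univ, if_true]
    exact one_le_pow₀ hR) 1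
  have h2 : ∑ i, R ^ (((1 : Equiv.Perm (Fin m)) i : Fin m) : ℕ) *
      (backProd A n r).mulVec (Pi.single j 1) i ≤ R ^ m * ∑ i, backProd A n r i j := by
    rw [Finset.mul_sum]
    refine Finset.sum_le_sum fun i _ => ?_
    rw [Matrix.mulVec_single_one]
    exact mul_le_mul_of_nonneg_right (pow_le_pow_right₀ hR i.2.le)
      (Matrix.nonneg_of_mem_rowStochastic (backProd_mem_rowStochastic hA n r))
  rw [inv_le_iff_one_le_mul₀ hRm]
  linarith

/-- A balanced chain with diagonals bounded below has an absolute sequence `π` of weights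
(`π(n) = π(n+1) A(n)`), bounded and bounded away from zero. The weights are an ultrafilter limit,
as `N → ∞`, of the column sums of `A(N-1) ⋯ A(n)`; they are not normalized to sum to one. -/
theorem exists_absolute_weights {m : ℕ} {A : ℕ → Matrix (Fin m) (Fin m) ℝ} {δ α : ℝ}
    (hA : ∀ n, A n ∈ Matrix.rowStochastic ℝ (Fin m)) (hδ0 : 0 < δ) (hδ : ∀ n i, δ ≤ A n i i)
    (hα : 0 < α) (hbal : ∀ n, ∀ S : Finset (Fin m), S.Nonempty → S ≠ Finset.univ →
      α * cutFlow (A n) Sᶜ ≤ cutFlow (A n) S) :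
    ∃ p : ℝ, 0 < p ∧ ∃ π : ℕ → Fin m → ℝ, (∀ n j, p ≤ π n j) ∧ (∀ n j, π n j ≤ m) ∧
      ∀ n j, π n j = ∑ i, π (n + 1) i * A n i j := by
  obtain ⟨p, hp, hcol⟩ := exists_le_sum_backProd hA hδ0 hδ hα hbal
  have hle : ∀ n r j, ∑ i, backProd A n r i j ≤ m := by
    intro n r j
    calc ∑ i, backProd A n r i j ≤ ∑ _i : Fin m, (1 : ℝ) := Finset.sum_le_sum fun i _ =>
          Matrix.le_one_of_mem_rowStochastic (backProd_mem_rowStochastic hA n r)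
      _ = m := by simp
  have hlim : ∀ n j, ∃ a ∈ Set.Icc p (m : ℝ), Tendsto
      (fun N => ∑ i, backProd A n (N - n) i j) (hyperfilter ℕ : Filter ℕ) (𝓝 a) := by
    intro n j
    refine isCompact_Icc.ultrafilter_le_nhds
      ((hyperfilter ℕ).map fun N => ∑ i, backProd A n (N - n) i j) ?_
    refine tendsto_principal.2 (Eventually.of_forall fun N => ⟨hcol _ _ _, hle _ _ _⟩)
  choose π hπ hπlim using hlim
  refine ⟨p, hp, π, fun n j => (hπ n j).1, fun n j => (hπ n j).2, fun n j => ?_⟩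
  refine tendsto_nhds_unique (hπlim n j) ?_
  have h1 : Tendsto (fun N => ∑ i, (∑ l, backProd A (n + 1) (N - (n + 1)) l i) * A n i j)
      (hyperfilter ℕ : Filter ℕ) (𝓝 (∑ i, π (n + 1) i * A n i j)) :=
    tendsto_finsetSum _ fun i _ => (hπlim (n + 1) i).mul_const _
  refine h1.congr' ?_
  have h2 : ∀ᶠ N in (hyperfilter ℕ : Filter ℕ), n + 1 ≤ N :=
    Nat.hyperfilter_le_atTop (eventually_ge_atTop (n + 1))
  filter_upwards [h2] with N hN
  have h3 : N - n = (N - (n + 1)) + 1 := by omega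
  rw [h3, backProd]
  simp only [Matrix.mul_apply, Finset.sum_mul]
  exact Finset.sum_comm

/-! ### A pathwise convergence criterion -/

/-- A real sequence with vanishing increments comes close infinitely often to every point which
it crosses infinitely often. -/
theorem frequently_abs_sub_lt {y : ℕ → ℝ} (hy : Tendsto (fun n => y (n + 1) - y n) atTop (𝓝 0))
    {c ε : ℝ} (hε : 0 < ε) (hlt : ∃ᶠ n in atTop, y n < c) (hgt : ∃ᶠ n in atTop, c < y n) :
    ∃ᶠ n in atTop, |y n - c| < ε := by
  rw [frequently_atTop] at hlt hgt ⊢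
  intro N
  obtain ⟨N₁, hN₁⟩ := eventually_atTop.1 ((tendsto_order.1 hy).2 ε hε)
  obtain ⟨n₁, hn₁, h₁⟩ := hlt (max N N₁)
  obtain ⟨n₂, hn₂, h₂⟩ := hgt n₁
  classical
  have hex : ∃ k, c ≤ y (n₁ + k) := ⟨n₂ - n₁, by rw [Nat.add_sub_cancel' hn₂]; exact h₂.le⟩
  -- the first time after `n₁` at which the sequence is at least `c`
  obtain ⟨k, hk⟩ : ∃ k, Nat.find hex = k := ⟨_, rfl⟩
  have hspec := Nat.find_spec hex
  rw [hk] at hspec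
  rcases k with _ | k
  · exact absurd hspec (not_le.2 h₁)
  · have hmin := Nat.find_min hex (m := k) (by omega)
    have hinc := hN₁ (n₁ + k) (by have := le_max_right N N₁; omega)
    have hN : N ≤ n₁ := (le_max_left _ _).trans hn₁
    refine ⟨n₁ + (k + 1), by omega, ?_⟩
    rw [← add_assoc] at hspec ⊢
    rw [abs_lt]
    constructor <;> linarith [not_le.1 hmin]

/-- The tent function of height `2 ε` over `(c - ε, c + ε)`, written as a combination of the convex
functions `|· - a|`. -/
def tent (c ε y : ℝ) : ℝ := |y - (c - ε)| + |y - (c + ε)| - 2 * |y - c|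

theorem tent_nonneg (c ε y : ℝ) : 0 ≤ tent c ε y := by
  unfold tent
  have := abs_add_le (y - (c - ε)) (y - (c + ε))
  rw [show y - (c - ε) + (y - (c + ε)) = 2 * (y - c) by ring, abs_mul, abs_two] at this
  linarith

theorem abs_sub_lt_of_tent_pos {c ε y : ℝ} (hε : 0 < ε) (h : 0 < tent c ε y) : |y - c| < ε := by
  unfold tent at h
  by_contra hc
  rcases le_abs.1 (not_lt.1 hc) with h1 | h1
  · rw [abs_of_nonneg (by linarith : 0 ≤ y - (c - ε)), abs_of_nonneg (by linarith : 0 ≤ y - (c + ε)),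
      abs_of_nonneg (by linarith : 0 ≤ y - c)] at h
    linarith
  · rw [abs_of_nonpos (by linarith : y - (c - ε) ≤ 0), abs_of_nonpos (by linarith : y - (c + ε) ≤ 0),
      abs_of_nonpos (by linarith : y - c ≤ 0)] at h
    linarith

theorem le_tent {c ε y : ℝ} (h : |y - c| < ε / 2) : ε ≤ tent c ε y := by
  unfold tent
  have h' := abs_lt.1 h
  rw [abs_of_nonneg (by linarith : 0 ≤ y - (c - ε)), abs_of_nonpos (by linarith : y - (c + ε) ≤ 0)]
  linarith

/-- If a coordinate had a nontrivial interval of cluster points, that interval would contain `m + 1`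
disjoint tents, each visited infinitely often. The weighted sum of a tent over the coordinates
converges, hence to a positive limit, so that eventually each tent contains one of the `m`
coordinates: a contradiction. -/
theorem exists_tendsto_of_weighted_abs {m : ℕ} {π x : ℕ → Fin m → ℝ} {p : ℝ} (hp : 0 < p)
    (hπ : ∀ n i, p ≤ π n i) (hx : ∀ n i, x n i ∈ Set.Icc (0 : ℝ) 1)
    (hconv : ∀ c : ℚ, ∃ l, Tendsto (fun n => ∑ i, π n i * |x n i - c|) atTop (𝓝 l))
    (hinc : ∀ i, Tendsto (fun n => x (n + 1) i - x n i) atTop (𝓝 0)) (i : Fin m) :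
    ∃ l, Tendsto (fun n => x n i) atTop (𝓝 l) := by
  refine tendsto_of_no_upcrossings (s := Set.range ((↑) : ℚ → ℝ)) Rat.denseRange_cast ?_
    (isBoundedUnder_of ⟨1, fun n => (hx n i).2⟩) (isBoundedUnder_of ⟨0, fun n => (hx n i).1⟩)
  rintro _ ⟨a, rfl⟩ _ ⟨b, rfl⟩ hab ⟨hlt, hgt⟩
  have hab' : (0 : ℚ) < b - a := sub_pos.2 (by exact_mod_cast hab)
  -- `m + 1` rational points of `(a, b)` at mutual distance at least `2 * ε`
  set ε : ℚ := (b - a) / (2 * (m + 2)) with hεdef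
  have hε : 0 < ε := by positivity
  have hεR : (0 : ℝ) < ε := by exact_mod_cast hε
  have hb : a + 2 * (m + 2) * ε = b := by rw [hεdef]; field_simp; ring
  have hbR : (a : ℝ) + 2 * (m + 2) * ε = b := by exact_mod_cast hb
  set c : Fin (m + 1) → ℚ := fun k => a + 2 * ε * (k + 1) with hc
  have hev : ∀ k : Fin (m + 1), ∀ᶠ n in atTop, ∃ l : Fin m, |x n l - c k| < ε := by
    intro k
    have hcR : (c k : ℝ) = a + 2 * ε * (k + 1) := by simp [hc]
    have hk : (k : ℝ) ≤ m := by exact_mod_cast Nat.lt_succ_iff.1 k.2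
    have hk0 : (0 : ℝ) ≤ k := Nat.cast_nonneg _
    have hac : (a : ℝ) < c k := by rw [hcR]; nlinarith
    have hcb : (c k : ℝ) < b := by rw [hcR, ← hbR]; nlinarith
    have hfreq := frequently_abs_sub_lt (hinc i) (half_pos hεR)
      (hlt.mono fun n h => h.trans hac) (hgt.mono fun n h => hcb.trans h)
    obtain ⟨L, hL⟩ : ∃ L, Tendsto (fun n => ∑ i, π n i * tent (c k) ε (x n i)) atTop (𝓝 L) := by
      obtain ⟨l₁, h₁⟩ := hconv (c k - ε)
      obtain ⟨l₂, h₂⟩ := hconv (c k + ε)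
      obtain ⟨l₃, h₃⟩ := hconv (c k)
      refine ⟨_, ((h₁.add h₂).sub (h₃.const_mul 2)).congr fun n => ?_⟩
      rw [Finset.mul_sum, ← Finset.sum_add_distrib, ← Finset.sum_sub_distrib]
      refine Finset.sum_congr rfl fun i _ => ?_
      rw [tent]
      push_cast
      ring
    have hnn : ∀ n l, 0 ≤ π n l * tent (c k) ε (x n l) := fun n l =>
      mul_nonneg (hp.le.trans (hπ n l)) (tent_nonneg _ _ _)
    have hLpos : 0 < L := by
      refine (mul_pos hp hεR).trans_le (ge_of_tendsto_of_frequently hL (hfreq.mono fun n h => ?_))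
      exact (mul_le_mul (hπ n i) (le_tent h) hεR.le (hp.le.trans (hπ n i))).trans
        (Finset.single_le_sum (fun l _ => hnn n l) (Finset.mem_univ i))
    filter_upwards [(tendsto_order.1 hL).1 0 hLpos] with n hn
    obtain ⟨l, -, hl⟩ := Finset.exists_lt_of_sum_lt (s := Finset.univ) (f := fun _ : Fin m => (0 : ℝ))
      (g := fun l => π n l * tent (c k) ε (x n l)) (by simpa using hn)
    exact ⟨l, abs_sub_lt_of_tent_pos hεR (pos_of_mul_pos_right hl (hp.le.trans (hπ n l)))⟩
  obtain ⟨n, hn⟩ := (eventually_all.2 hev).exists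
  choose f hf using hn
  obtain ⟨k, k', hne, hkk⟩ := Fintype.exists_ne_map_eq_of_card_lt f (by simp)
  have h1 := abs_lt.1 (hf k)
  have h2 := abs_lt.1 (hf k')
  rw [← hkk] at h2
  have h3 : |(c k : ℝ) - c k'| < 2 * ε := by rw [abs_lt]; constructor <;> linarith
  have h4 : (c k : ℝ) - c k' = 2 * ε * ((((k : ℕ) : ℤ) - ((k' : ℕ) : ℤ) : ℤ) : ℝ) := by
    simp only [hc]
    push_cast
    ring
  rw [h4, abs_mul, abs_of_pos (by positivity : (0 : ℝ) < 2 * ε)] at h3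
  have h5 : (1 : ℤ) ≤ |((k : ℕ) : ℤ) - ((k' : ℕ) : ℤ)| :=
    Int.one_le_abs (sub_ne_zero.2 fun h => hne (Fin.ext (Int.ofNat_inj.1 h)))
  have h6 : (1 : ℝ) ≤ |((((k : ℕ) : ℤ) - ((k' : ℕ) : ℤ) : ℤ) : ℝ)| := by
    rw [← Int.cast_abs]
    exact_mod_cast h5
  nlinarith

/-! ### Random trajectories -/

section Trajectory

variable {m : ℕ} {Ω : Type*} {V : ℕ → Ω → Matrix (Fin m) (Fin m) ℝ}

/-- The trajectory `x(n+1) = V(n) x(n)`, `x(0) = x₀`. -/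
def traj (V : ℕ → Ω → Matrix (Fin m) (Fin m) ℝ) (x₀ : Fin m → ℝ) : ℕ → Ω → Fin m → ℝ
  | 0, _ => x₀
  | n + 1, ω => (V n ω).mulVec (traj V x₀ n ω)

theorem traj_mem_Icc (hst : ∀ n ω, V n ω ∈ Matrix.rowStochastic ℝ (Fin m)) {x₀ : Fin m → ℝ}
    (hx₀ : ∀ i, x₀ i ∈ Set.Icc (0 : ℝ) 1) (n : ℕ) (ω : Ω) (i : Fin m) :
    traj V x₀ n ω i ∈ Set.Icc (0 : ℝ) 1 := by
  induction n generalizing i with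
  | zero => exact hx₀ i
  | succ n ih =>
    have hnn : ∀ j, 0 ≤ V n ω i j := fun j => Matrix.nonneg_of_mem_rowStochastic (hst n ω)
    simp only [traj, Matrix.mulVec, dotProduct]
    refine ⟨Finset.sum_nonneg fun j _ => mul_nonneg (hnn j) (ih j).1, ?_⟩
    rw [← Matrix.sum_row_of_mem_rowStochastic (hst n ω) i]
    exact Finset.sum_le_sum fun j _ => mul_le_of_le_one_right (hnn j) (ih j).2

variable [mΩ : MeasurableSpace Ω] {μ : Measure Ω}

/-- The filtration whose `n`-th member is generated by `V(0), …, V(n-1)`, that is, by the matrices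
that determine the trajectory at time `n`. -/
def past (V : ℕ → Ω → Matrix (Fin m) (Fin m) ℝ)
    (hV : ∀ n, Measurable fun ω i j => V n ω i j) : Filtration ℕ mΩ where
  seq n := ⨆ k ∈ Set.Iio n, MeasurableSpace.comap (fun ω i j => V k ω i j) inferInstance
  mono' _ _ h := biSup_mono fun _ hk => lt_of_lt_of_le hk h
  le' _ := iSup₂_le fun k _ => (hV k).comap_le

theorem measurable_past_traj (hV : ∀ n, Measurable fun ω i j => V n ω i j) (x₀ : Fin m → ℝ)
    (n : ℕ) (i : Fin m) : Measurable[past V hV n] fun ω => traj V x₀ n ω i := by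
  induction n generalizing i with
  | zero => exact measurable_const
  | succ n ih =>
    have hentry : ∀ j, Measurable[past V hV (n + 1)] fun ω => V n ω i j := by
      intro j
      have h1 : Measurable[MeasurableSpace.comap (fun ω i j => V n ω i j) inferInstance]
          fun ω => V n ω i j :=
        (measurable_pi_apply j).comp ((measurable_pi_apply i).comp (comap_measurable _))
      exact h1.mono (le_biSup (fun k => MeasurableSpace.comap (fun ω i j => V k ω i j)
        inferInstance) (Set.mem_Iio.2 n.lt_succ_self)) le_rfl
    have hprev : ∀ j, Measurable[past V hV (n + 1)] fun ω => traj V x₀ n ω j := fun j =>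
      (ih j).mono ((past V hV).mono n.le_succ) le_rfl
    simp only [traj, Matrix.mulVec, dotProduct]
    exact Finset.measurable_sum _ fun j _ => (hentry j).mul (hprev j)

theorem measurable_traj (hV : ∀ n, Measurable fun ω i j => V n ω i j) (x₀ : Fin m → ℝ)
    (n : ℕ) (i : Fin m) : Measurable fun ω => traj V x₀ n ω i :=
  (measurable_past_traj hV x₀ n i).mono ((past V hV).le n) le_rfl

/-- The matrix `V(n)` is independent of the past. -/
theorem integral_mul_past (hV : ∀ n, Measurable fun ω i j => V n ω i j)
    (hind : iIndepFun (fun (n : ℕ) (ω : Ω) (i j : Fin m) => V n ω i j) μ)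
    {f : (Fin m → Fin m → ℝ) → ℝ} (hf : Measurable f) {n : ℕ} {Z : Ω → ℝ}
    (hZ : Measurable[past V hV n] Z) :
    ∫ ω, f (V n ω) * Z ω ∂μ = (∫ ω, f (V n ω) ∂μ) * ∫ ω, Z ω ∂μ := by
  have h1 := indep_iSup_of_disjoint (fun k => (hV k).comap_le) hind
    (S := {n}) (T := Set.Iio n) (by simp)
  have h2 : IndepFun (fun ω => f (V n ω)) Z μ := by
    rw [IndepFun_iff_Indep]
    refine indep_of_indep_of_le_left (indep_of_indep_of_le_right h1 hZ.comap_le) ?_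
    refine (Measurable.comap_le ?_).trans (le_biSup (fun k => MeasurableSpace.comap
      (fun ω i j => V k ω i j) inferInstance) (Set.mem_singleton n))
    exact hf.comp (comap_measurable _)
  exact h2.integral_fun_mul_eq_mul_integral (hf.comp (hV n)).aestronglyMeasurable
    (hZ.mono ((past V hV).le n) le_rfl).aestronglyMeasurable

/-- Convexity of `|· - c|` along rows and `π(n) = π(n+1) E[V(n)]` make the weighted sum of
`|x_i(n) - c|` a supermartingale. -/
theorem supermartingale_weighted_abs [IsProbabilityMeasure μ]
    (hV : ∀ n, Measurable fun ω i j => V n ω i j)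
    (hst : ∀ n ω, V n ω ∈ Matrix.rowStochastic ℝ (Fin m))
    (hind : iIndepFun (fun (n : ℕ) (ω : Ω) (i j : Fin m) => V n ω i j) μ)
    {π : ℕ → Fin m → ℝ} (hπ0 : ∀ n i, 0 ≤ π n i)
    (hπ : ∀ n j, π n j = ∑ i, π (n + 1) i * ∫ ω, V n ω i j ∂μ)
    {x₀ : Fin m → ℝ} (hx₀ : ∀ i, x₀ i ∈ Set.Icc (0 : ℝ) 1) (c : ℝ) :
    Supermartingale (fun n ω => ∑ i, π n i * |traj V x₀ n ω i - c|) (past V hV) μ := by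
  have hVij : ∀ n i j, Measurable fun ω => V n ω i j := fun n i j =>
    (measurable_pi_apply j).comp ((measurable_pi_apply i).comp (hV n))
  have habs : ∀ n i, Measurable[past V hV n] fun ω => |traj V x₀ n ω i - c| := fun n i =>
    continuous_abs.measurable.comp ((measurable_past_traj hV x₀ n i).sub_const c)
  have hbd : ∀ n i ω, |traj V x₀ n ω i - c| ≤ 1 + |c| := by
    intro n i ω
    have h := traj_mem_Icc hst hx₀ n ω i
    calc _ ≤ |traj V x₀ n ω i| + |c| := abs_sub _ _
      _ ≤ 1 + |c| := by rw [abs_of_nonneg h.1]; linarith [h.2]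
  have habs' : ∀ n i, Measurable fun ω => |traj V x₀ n ω i - c| := fun n i =>
    (habs n i).mono ((past V hV).le n) le_rfl
  have hint : ∀ n i, Integrable (fun ω => |traj V x₀ n ω i - c|) μ := fun n i =>
    Integrable.of_bound (habs' n i).aestronglyMeasurable (1 + |c|)
      (Eventually.of_forall fun ω => by simpa using hbd n i ω)
  have hintV : ∀ n i j, Integrable (fun ω => V n ω i j * |traj V x₀ n ω j - c|) μ := by
    intro n i j
    refine (hint n j).mono ((hVij n i j).mul (habs' n j)).aestronglyMeasurable
      (Eventually.of_forall fun ω => ?_)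
    rw [norm_mul]
    refine mul_le_of_le_one_left (norm_nonneg _) ?_
    rw [Real.norm_of_nonneg (Matrix.nonneg_of_mem_rowStochastic (hst n ω))]
    exact Matrix.le_one_of_mem_rowStochastic (hst n ω)
  refine supermartingale_of_setIntegral_succ_le
    (fun n => (Finset.measurable_sum _ fun i _ => (habs n i).const_mul (π n i)).stronglyMeasurable)
    (fun n => integrable_finsetSum _ fun i _ => (hint n i).const_mul _) ?_
  intro n s hs
  have hs' : MeasurableSet s := (past V hV).le n s hs
  have hset : ∀ i j, ∫ ω in s, V n ω i j * |traj V x₀ n ω j - c| ∂μ =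
      (∫ ω, V n ω i j ∂μ) * ∫ ω in s, |traj V x₀ n ω j - c| ∂μ := by
    intro i j
    rw [← integral_indicator hs', ← integral_indicator hs',
      ← integral_mul_past hV hind (f := fun M => M i j)
        ((measurable_pi_apply j).comp (measurable_pi_apply i)) ((habs n j).indicator hs)]
    refine integral_congr_ae (Eventually.of_forall fun ω => ?_)
    by_cases h : ω ∈ s <;> simp [h]
  calc ∫ ω in s, ∑ i, π (n + 1) i * |traj V x₀ (n + 1) ω i - c| ∂μ
      ≤ ∫ ω in s, ∑ i, π (n + 1) i * ∑ j, V n ω i j * |traj V x₀ n ω j - c| ∂μ := by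
        refine integral_mono
          (integrable_finsetSum _ fun i _ => ((hint _ i).const_mul _)).integrableOn
          (integrable_finsetSum _ fun i _ =>
            (integrable_finsetSum _ fun j _ => hintV n i j).const_mul _).integrableOn fun ω => ?_
        refine Finset.sum_le_sum fun i _ => mul_le_mul_of_nonneg_left ?_ (hπ0 _ _)
        have h1 : traj V x₀ (n + 1) ω i - c = ∑ j, V n ω i j * (traj V x₀ n ω j - c) := by
          simp only [traj, Matrix.mulVec, dotProduct, mul_sub, Finset.sum_sub_distrib]
          rw [← Finset.sum_mul, Matrix.sum_row_of_mem_rowStochastic (hst n ω), one_mul]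
        rw [h1]
        refine (Finset.abs_sum_le_sum_abs _ _).trans (Finset.sum_le_sum fun j _ => ?_)
        rw [abs_mul, abs_of_nonneg (Matrix.nonneg_of_mem_rowStochastic (hst n ω))]
    _ = ∑ i, π (n + 1) i * ∑ j, (∫ ω, V n ω i j ∂μ) * ∫ ω in s, |traj V x₀ n ω j - c| ∂μ := by
        rw [integral_finsetSum _ fun i _ =>
            ((integrable_finsetSum _ fun j _ => hintV n i j).const_mul _).integrableOn]
        refine Finset.sum_congr rfl fun i _ => ?_
        rw [integral_const_mul, integral_finsetSum _ fun j _ => (hintV n i j).integrableOn]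
        simp only [hset]
    _ = ∑ j, π n j * ∫ ω in s, |traj V x₀ n ω j - c| ∂μ := by
        simp only [Finset.mul_sum, hπ n, Finset.sum_mul]
        rw [Finset.sum_comm]
        simp only [mul_assoc]
    _ = ∫ ω in s, ∑ i, π n i * |traj V x₀ n ω i - c| ∂μ := by
        rw [integral_finsetSum _ fun i _ => ((hint n i).const_mul _).integrableOn]
        simp only [integral_const_mul]

theorem ae_exists_tendsto_weighted_abs [IsProbabilityMeasure μ]
    (hV : ∀ n, Measurable fun ω i j => V n ω i j)
    (hst : ∀ n ω, V n ω ∈ Matrix.rowStochastic ℝ (Fin m))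
    (hind : iIndepFun (fun (n : ℕ) (ω : Ω) (i j : Fin m) => V n ω i j) μ)
    {π : ℕ → Fin m → ℝ} (hπ0 : ∀ n i, 0 ≤ π n i) {B : ℝ} (hπB : ∀ n i, π n i ≤ B)
    (hπ : ∀ n j, π n j = ∑ i, π (n + 1) i * ∫ ω, V n ω i j ∂μ)
    {x₀ : Fin m → ℝ} (hx₀ : ∀ i, x₀ i ∈ Set.Icc (0 : ℝ) 1) (c : ℝ) :
    ∀ᵐ ω ∂μ, ∃ l, Tendsto (fun n => ∑ i, π n i * |traj V x₀ n ω i - c|) atTop (𝓝 l) := by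
  have hsuper := supermartingale_weighted_abs hV hst hind hπ0 hπ hx₀ c
  have hbound : ∀ n ω, ‖∑ i, π n i * |traj V x₀ n ω i - c|‖ ≤ ∑ _i : Fin m, B * (1 + |c|) := by
    intro n ω
    rw [Real.norm_of_nonneg (Finset.sum_nonneg fun i _ => mul_nonneg (hπ0 n i) (abs_nonneg _))]
    refine Finset.sum_le_sum fun i _ => ?_
    have h := traj_mem_Icc hst hx₀ n ω i
    refine mul_le_mul (hπB n i) ?_ (abs_nonneg _) ((hπ0 n i).trans (hπB n i))
    calc _ ≤ |traj V x₀ n ω i| + |c| := abs_sub _ _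
      _ ≤ 1 + |c| := by rw [abs_of_nonneg h.1]; linarith [h.2]
  have h := hsuper.neg.exists_ae_tendsto_of_bdd
    (R := (∑ _i : Fin m, B * (1 + |c|)).toNNReal) (by
      intro n
      refine (eLpNorm_le_of_ae_bound (C := ∑ _i : Fin m, B * (1 + |c|))
        (Eventually.of_forall fun ω => ?_)).trans ?_
      · rw [Pi.neg_apply, Pi.neg_apply, norm_neg]
        exact hbound n ω
      · simp [ENNReal.ofReal])
  filter_upwards [h] with ω ⟨l, hl⟩
  refine ⟨-l, hl.neg.congr fun n => ?_⟩
  simp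

/-- Jensen's inequality for the square, keeping the part of the variance that involves the fixed
index `i`. -/
theorem sq_sum_le_of_sum_eq_one {w x : Fin m → ℝ} (hw : ∀ j, 0 ≤ w j) (hw1 : ∑ j, w j = 1)
    (i : Fin m) :
    (∑ j, w j * x j) ^ 2 ≤
      ∑ j, w j * x j ^ 2 - 1 / 2 * ∑ l, w i * w l * (x i - x l) ^ 2 := by
  have h1 : ∑ j, ∑ l, w j * w l * (x j - x l) ^ 2 =
      2 * ∑ j, w j * x j ^ 2 - 2 * (∑ j, w j * x j) ^ 2 := by
    have h2 : ∀ j l, w j * w l * (x j - x l) ^ 2 =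
        w j * x j ^ 2 * w l - 2 * ((w j * x j) * (w l * x l)) + w j * (w l * x l ^ 2) := by
      intro j l
      ring
    simp only [h2, Finset.sum_add_distrib, Finset.sum_sub_distrib, ← Finset.mul_sum,
      ← Finset.sum_mul, hw1]
    ring
  have h3 : ∑ l, w i * w l * (x i - x l) ^ 2 ≤ ∑ j, ∑ l, w j * w l * (x j - x l) ^ 2 :=
    Finset.single_le_sum (f := fun j => ∑ l, w j * w l * (x j - x l) ^ 2)
      (fun j _ => Finset.sum_nonneg fun l _ =>
        mul_nonneg (mul_nonneg (hw j) (hw l)) (sq_nonneg _)) (Finset.mem_univ i)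
  linarith

/-- The weighted sum of squares `∑ i, π_i(n) x_i(n)²` has decreasing expectation. By strong
aperiodicity the drop at time `n` is at least a constant times `E[V_il(n)] E[(x_i(n) - x_l(n))²]`,
so that these terms are summable. -/
theorem summable_integral_mul_integral_sq [IsProbabilityMeasure μ]
    (hV : ∀ n, Measurable fun ω i j => V n ω i j)
    (hst : ∀ n ω, V n ω ∈ Matrix.rowStochastic ℝ (Fin m))
    (hind : iIndepFun (fun (n : ℕ) (ω : Ω) (i j : Fin m) => V n ω i j) μ)
    {γ : ℝ} (hγ : 0 < γ) (hap : ∀ n, ∀ i j : Fin m, i ≠ j →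
      γ * ∫ ω, V n ω i j ∂μ ≤ ∫ ω, V n ω i i * V n ω i j ∂μ)
    {π : ℕ → Fin m → ℝ} {p : ℝ} (hp : 0 < p) (hπp : ∀ n i, p ≤ π n i)
    (hπ : ∀ n j, π n j = ∑ i, π (n + 1) i * ∫ ω, V n ω i j ∂μ)
    {x₀ : Fin m → ℝ} (hx₀ : ∀ i, x₀ i ∈ Set.Icc (0 : ℝ) 1) (i l : Fin m) :
    Summable fun n => (∫ ω, V n ω i l ∂μ) *
      ∫ ω, (traj V x₀ n ω i - traj V x₀ n ω l) ^ 2 ∂μ := by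
  have hVij : ∀ n i j, Measurable fun ω => V n ω i j := fun n i j =>
    (measurable_pi_apply j).comp ((measurable_pi_apply i).comp (hV n))
  have hV0 : ∀ n ω i j, 0 ≤ V n ω i j := fun n ω i j =>
    Matrix.nonneg_of_mem_rowStochastic (hst n ω)
  have hV1 : ∀ n ω i j, V n ω i j ≤ 1 := fun n ω i j =>
    Matrix.le_one_of_mem_rowStochastic (hst n ω)
  have hbdd : ∀ f : Ω → ℝ, Measurable f → (∀ ω, f ω ∈ Set.Icc (0 : ℝ) 1) → Integrable f μ :=
    fun f hf h => Integrable.of_mem_Icc 0 1 hf.aemeasurable (Eventually.of_forall h)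
  have hmx := measurable_past_traj hV x₀
  have hmx' := measurable_traj hV x₀
  have hx := traj_mem_Icc hst hx₀
  have hsq : ∀ n ω i, traj V x₀ n ω i ^ 2 ∈ Set.Icc (0 : ℝ) 1 := fun n ω i =>
    ⟨sq_nonneg _, pow_le_one₀ (hx n ω i).1 (hx n ω i).2⟩
  have hdiff : ∀ n ω i l, (traj V x₀ n ω i - traj V x₀ n ω l) ^ 2 ∈ Set.Icc (0 : ℝ) 1 := by
    intro n ω i l
    refine ⟨sq_nonneg _, (sq_le_one_iff_abs_le_one _).2 (abs_le.2 ⟨?_, ?_⟩)⟩ <;>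
      linarith [(hx n ω i).1, (hx n ω i).2, (hx n ω l).1, (hx n ω l).2]
  have hIsq : ∀ n i, Integrable (fun ω => traj V x₀ n ω i ^ 2) μ := fun n i =>
    hbdd _ ((hmx' n i).pow_const 2) fun ω => hsq n ω i
  have hIV : ∀ n i j, Integrable (fun ω => V n ω i j * traj V x₀ n ω j ^ 2) μ := fun n i j =>
    hbdd _ ((hVij n i j).mul ((hmx' n j).pow_const 2)) fun ω =>
      ⟨mul_nonneg (hV0 n ω i j) (hsq n ω j).1, mul_le_one₀ (hV1 n ω i j) (hsq n ω j).1 (hsq n ω j).2⟩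
  have hIVV : ∀ n i l, Integrable (fun ω => V n ω i i * V n ω i l *
      (traj V x₀ n ω i - traj V x₀ n ω l) ^ 2) μ := fun n i l =>
    hbdd _ (((hVij n i i).mul (hVij n i l)).mul (((hmx' n i).sub (hmx' n l)).pow_const 2)) fun ω =>
      ⟨mul_nonneg (mul_nonneg (hV0 _ _ _ _) (hV0 _ _ _ _)) (sq_nonneg _),
        mul_le_one₀ (mul_le_one₀ (hV1 _ _ _ _) (hV0 _ _ _ _) (hV1 _ _ _ _)) (sq_nonneg _)
          (hdiff n ω i l).2⟩
  set D : ℕ → Fin m → Fin m → ℝ := fun n i l =>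
    (∫ ω, V n ω i l ∂μ) * ∫ ω, (traj V x₀ n ω i - traj V x₀ n ω l) ^ 2 ∂μ with hD
  have hD0 : ∀ n i l, 0 ≤ D n i l := fun n i l =>
    mul_nonneg (integral_nonneg fun ω => hV0 n ω i l) (integral_nonneg fun ω => sq_nonneg _)
  set u : ℕ → ℝ := fun n => ∑ i, π n i * ∫ ω, traj V x₀ n ω i ^ 2 ∂μ with hu
  have hu0 : ∀ n, 0 ≤ u n := fun n => Finset.sum_nonneg fun i _ =>
    mul_nonneg (hp.le.trans (hπp n i)) (integral_nonneg fun ω => sq_nonneg _)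
  have hrow : ∀ n i, ∫ ω, traj V x₀ (n + 1) ω i ^ 2 ∂μ ≤
      ∑ j, (∫ ω, V n ω i j ∂μ) * ∫ ω, traj V x₀ n ω j ^ 2 ∂μ - 1 / 2 * ∑ l, γ * D n i l := by
    intro n i
    calc ∫ ω, traj V x₀ (n + 1) ω i ^ 2 ∂μ
        ≤ ∫ ω, (∑ j, V n ω i j * traj V x₀ n ω j ^ 2 - 1 / 2 * ∑ l, V n ω i i * V n ω i l *
            (traj V x₀ n ω i - traj V x₀ n ω l) ^ 2) ∂μ := by
          refine integral_mono (hIsq (n + 1) i) ((integrable_finsetSum _ fun j _ => hIV n i j).sub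
            ((integrable_finsetSum _ fun l _ => hIVV n i l).const_mul _)) fun ω => ?_
          exact sq_sum_le_of_sum_eq_one (fun j => hV0 n ω i j)
            (Matrix.sum_row_of_mem_rowStochastic (hst n ω) i) i
      _ = ∑ j, (∫ ω, V n ω i j ∂μ) * ∫ ω, traj V x₀ n ω j ^ 2 ∂μ -
          1 / 2 * ∑ l, (∫ ω, V n ω i i * V n ω i l ∂μ) *
            ∫ ω, (traj V x₀ n ω i - traj V x₀ n ω l) ^ 2 ∂μ := by
          rw [integral_sub (integrable_finsetSum _ fun j _ => hIV n i j)
            ((integrable_finsetSum _ fun l _ => hIVV n i l).const_mul _), integral_const_mul,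
            integral_finsetSum _ fun j _ => hIV n i j,
            integral_finsetSum _ fun l _ => hIVV n i l]
          congr 1
          · exact Finset.sum_congr rfl fun j _ => integral_mul_past hV hind (f := fun M => M i j)
              ((measurable_pi_apply j).comp (measurable_pi_apply i)) ((hmx n j).pow_const 2)
          · congr 1
            have hf : Measurable fun M : Fin m → Fin m → ℝ => M i i := by fun_prop
            have hg : ∀ l, Measurable fun M : Fin m → Fin m → ℝ => M i l := fun l => by fun_prop
            exact Finset.sum_congr rfl fun l _ => integral_mul_past hV hind
              (f := fun M => M i i * M i l) (hf.mul (hg l)) (((hmx n i).sub (hmx n l)).pow_const 2)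
      _ ≤ _ := by
          refine sub_le_sub_left (mul_le_mul_of_nonneg_left
            (Finset.sum_le_sum fun l _ => ?_) (by norm_num)) _
          -- strong aperiodicity says nothing for `i = l`, where the difference vanishes
          by_cases h : i = l
          · subst h
            simp [hD]
          · simp only [hD]
            rw [← mul_assoc]
            exact mul_le_mul_of_nonneg_right (hap n i l h) (integral_nonneg fun ω => sq_nonneg _)
  have hstep : ∀ n, u (n + 1) ≤ u n - p * (1 / 2 * γ) * D n i l := by
    intro n
    have h1 : u (n + 1) ≤ ∑ i, π (n + 1) i *
        (∑ j, (∫ ω, V n ω i j ∂μ) * ∫ ω, traj V x₀ n ω j ^ 2 ∂μ - 1 / 2 * ∑ l, γ * D n i l) :=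
      Finset.sum_le_sum fun i _ => mul_le_mul_of_nonneg_left (hrow n i) (hp.le.trans (hπp _ _))
    have h2 : ∑ i, π (n + 1) i * ∑ j, (∫ ω, V n ω i j ∂μ) * ∫ ω, traj V x₀ n ω j ^ 2 ∂μ = u n := by
      simp only [hu, Finset.mul_sum, hπ n, Finset.sum_mul]
      rw [Finset.sum_comm]
      simp only [mul_assoc]
    have h3 : p * (1 / 2 * γ) * D n i l ≤ ∑ i, π (n + 1) i * (1 / 2 * ∑ l, γ * D n i l) := by
      have hnn : ∀ i, 0 ≤ 1 / 2 * ∑ l, γ * D n i l := fun i =>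
        mul_nonneg (by norm_num) (Finset.sum_nonneg fun l _ => mul_nonneg hγ.le (hD0 n i l))
      have h4 : γ * D n i l ≤ ∑ l, γ * D n i l :=
        Finset.single_le_sum (f := fun l => γ * D n i l)
          (fun l _ => mul_nonneg hγ.le (hD0 n i l)) (Finset.mem_univ l)
      calc p * (1 / 2 * γ) * D n i l = p * (1 / 2 * (γ * D n i l)) := by ring
        _ ≤ p * (1 / 2 * ∑ l, γ * D n i l) := by gcongr
        _ ≤ π (n + 1) i * (1 / 2 * ∑ l, γ * D n i l) :=
          mul_le_mul_of_nonneg_right (hπp _ _) (hnn i)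
        _ ≤ _ := Finset.single_le_sum (f := fun i => π (n + 1) i * (1 / 2 * ∑ l, γ * D n i l))
          (fun i _ => mul_nonneg (hp.le.trans (hπp _ _)) (hnn i)) (Finset.mem_univ i)
    simp only [mul_sub, Finset.sum_sub_distrib] at h1
    linarith
  have hK : 0 < p * (1 / 2 * γ) := by positivity
  refine summable_of_sum_range_le (c := u 0 / (p * (1 / 2 * γ))) (fun n => hD0 n i l) fun N => ?_
  rw [le_div_iff₀ hK]
  have : ∀ N, (∑ n ∈ Finset.range N, D n i l) * (p * (1 / 2 * γ)) ≤ u 0 - u N := by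
    intro N
    induction N with
    | zero => simp
    | succ N ih =>
      rw [Finset.sum_range_succ, add_mul]
      linarith [hstep N]
  linarith [this N, hu0 N]

theorem ae_summable_of_summable_integral {f : ℕ → Ω → ℝ} (hf : ∀ n, Integrable (f n) μ)
    (h0 : ∀ n, 0 ≤ᵐ[μ] f n) (hsum : Summable fun n => ∫ ω, f n ω ∂μ) :
    ∀ᵐ ω ∂μ, Summable fun n => f n ω := by
  have hmeas : ∀ n, AEMeasurable (fun ω => ENNReal.ofReal (f n ω)) μ := fun n =>
    (hf n).aestronglyMeasurable.aemeasurable.ennreal_ofReal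
  have h1 : ∫⁻ ω, ∑' n, ENNReal.ofReal (f n ω) ∂μ ≠ ⊤ := by
    rw [lintegral_tsum hmeas]
    simp only [← ofReal_integral_eq_lintegral_ofReal (hf _) (h0 _)]
    exact hsum.tsum_ofReal_ne_top
  filter_upwards [ae_lt_top' (AEMeasurable.tsum hmeas) h1, ae_all_iff.2 h0] with ω hω hω0
  refine (ENNReal.summable_toReal hω.ne).congr fun n => ?_
  exact ENNReal.toReal_ofReal (hω0 n)

/-- Trajectories converge, and the limits at `i` and `l` agree when `∑ n, E[V_il(n)] = ∞`. -/
theorem ae_tendsto_traj [IsProbabilityMeasure μ]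
    (hV : ∀ n, Measurable fun ω i j => V n ω i j)
    (hst : ∀ n ω, V n ω ∈ Matrix.rowStochastic ℝ (Fin m))
    (hind : iIndepFun (fun (n : ℕ) (ω : Ω) (i j : Fin m) => V n ω i j) μ)
    {γ : ℝ} (hγ : 0 < γ) (hap : ∀ n, ∀ i j : Fin m, i ≠ j →
      γ * ∫ ω, V n ω i j ∂μ ≤ ∫ ω, V n ω i i * V n ω i j ∂μ)
    {π : ℕ → Fin m → ℝ} {p B : ℝ} (hp : 0 < p) (hπp : ∀ n i, p ≤ π n i)
    (hπB : ∀ n i, π n i ≤ B) (hπ : ∀ n j, π n j = ∑ i, π (n + 1) i * ∫ ω, V n ω i j ∂μ)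
    {x₀ : Fin m → ℝ} (hx₀ : ∀ i, x₀ i ∈ Set.Icc (0 : ℝ) 1) :
    ∀ᵐ ω ∂μ, ∃ y : Fin m → ℝ, (∀ i, Tendsto (fun n => traj V x₀ n ω i) atTop (𝓝 (y i))) ∧
      ∀ i l, (¬ Summable fun n => ∫ ω, V n ω i l ∂μ) → y i = y l := by
  have hVij : ∀ n i j, Measurable fun ω => V n ω i j := fun n i j =>
    (measurable_pi_apply j).comp ((measurable_pi_apply i).comp (hV n))
  have hV0 : ∀ n ω i j, 0 ≤ V n ω i j := fun n ω i j =>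
    Matrix.nonneg_of_mem_rowStochastic (hst n ω)
  have hV1 : ∀ n ω i j, V n ω i j ≤ 1 := fun n ω i j =>
    Matrix.le_one_of_mem_rowStochastic (hst n ω)
  have hA0 : ∀ n i l, 0 ≤ ∫ ω, V n ω i l ∂μ := fun n i l => integral_nonneg fun ω => hV0 n ω i l
  have hx := traj_mem_Icc hst hx₀
  have hmx := measurable_past_traj hV x₀
  have hmx' := measurable_traj hV x₀
  have hdiff : ∀ n ω i l, (traj V x₀ n ω i - traj V x₀ n ω l) ^ 2 ∈ Set.Icc (0 : ℝ) 1 := by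
    intro n ω i l
    refine ⟨sq_nonneg _, (sq_le_one_iff_abs_le_one _).2 (abs_le.2 ⟨?_, ?_⟩)⟩ <;>
      linarith [(hx n ω i).1, (hx n ω i).2, (hx n ω l).1, (hx n ω l).2]
  have hId : ∀ n i l, Integrable (fun ω => (traj V x₀ n ω i - traj V x₀ n ω l) ^ 2) μ :=
    fun n i l => Integrable.of_mem_Icc 0 1 (((hmx' n i).sub (hmx' n l)).pow_const 2).aemeasurable
      (Eventually.of_forall fun ω => hdiff n ω i l)
  have hsum := summable_integral_mul_integral_sq hV hst hind hγ hap hp hπp hπ hx₀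
  have h1 : ∀ᵐ ω ∂μ, ∀ c : ℚ, ∃ l,
      Tendsto (fun n => ∑ i, π n i * |traj V x₀ n ω i - c|) atTop (𝓝 l) :=
    ae_all_iff.2 fun c => ae_exists_tendsto_weighted_abs hV hst hind
      (fun n i => hp.le.trans (hπp n i)) hπB hπ hx₀ c
  have h2 : ∀ᵐ ω ∂μ, ∀ i l, Summable fun n =>
      (∫ ω', V n ω' i l ∂μ) * (traj V x₀ n ω i - traj V x₀ n ω l) ^ 2 := by
    refine ae_all_iff.2 fun i => ae_all_iff.2 fun l => ae_summable_of_summable_integral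
      (fun n => (hId n i l).const_mul _)
      (fun n => Eventually.of_forall fun ω => mul_nonneg (hA0 n i l) (sq_nonneg _)) ?_
    simpa only [integral_const_mul] using hsum i l
  have h3 : ∀ᵐ ω ∂μ, ∀ i l, Summable fun n =>
      V n ω i l * (traj V x₀ n ω i - traj V x₀ n ω l) ^ 2 := by
    refine ae_all_iff.2 fun i => ae_all_iff.2 fun l => ae_summable_of_summable_integral
      (fun n => Integrable.of_mem_Icc 0 1
        ((hVij n i l).mul (((hmx' n i).sub (hmx' n l)).pow_const 2)).aemeasurable
        (Eventually.of_forall fun ω => ⟨mul_nonneg (hV0 _ _ _ _) (sq_nonneg _),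
          mul_le_one₀ (hV1 _ _ _ _) (sq_nonneg _) (hdiff n ω i l).2⟩))
      (fun n => Eventually.of_forall fun ω => mul_nonneg (hV0 n ω i l) (sq_nonneg _)) ?_
    refine (hsum i l).congr fun n => (integral_mul_past hV hind (f := fun M => M i l)
      ((measurable_pi_apply l).comp (measurable_pi_apply i))
      (((hmx n i).sub (hmx n l)).pow_const 2)).symm
  filter_upwards [h1, h2, h3] with ω hω1 hω2 hω3
  -- by Jensen, the squared increment is at most the `n`-th term of a summable series
  have hinc : ∀ i, Tendsto (fun n => traj V x₀ (n + 1) ω i - traj V x₀ n ω i) atTop (𝓝 0) := by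
    intro i
    have hlim : Tendsto (fun n => ∑ l, V n ω i l * (traj V x₀ n ω i - traj V x₀ n ω l) ^ 2)
        atTop (𝓝 0) := by
      simpa using tendsto_finsetSum Finset.univ fun l _ => (hω3 i l).tendsto_atTop_zero
    have hle : ∀ n, (traj V x₀ (n + 1) ω i - traj V x₀ n ω i) ^ 2 ≤
        ∑ l, V n ω i l * (traj V x₀ n ω i - traj V x₀ n ω l) ^ 2 := by
      intro n
      have hw1 := Matrix.sum_row_of_mem_rowStochastic (hst n ω) i
      have h4 := sq_sum_le_of_sum_eq_one (x := fun l => traj V x₀ n ω l - traj V x₀ n ω i)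
        (fun l => hV0 n ω i l) hw1 i
      have h5 : ∑ l, V n ω i l * (traj V x₀ n ω l - traj V x₀ n ω i) =
          traj V x₀ (n + 1) ω i - traj V x₀ n ω i := by
        simp only [mul_sub, Finset.sum_sub_distrib, ← Finset.sum_mul, hw1, one_mul]
        rfl
      rw [h5] at h4
      refine h4.trans ((sub_le_self _ ?_).trans (le_of_eq ?_))
      · exact mul_nonneg (by norm_num) (Finset.sum_nonneg fun l _ =>
          mul_nonneg (mul_nonneg (hV0 _ _ _ _) (hV0 _ _ _ _)) (sq_nonneg _))
      · exact Finset.sum_congr rfl fun l _ => by ring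
    have hsq := squeeze_zero (fun n => sq_nonneg _) hle hlim
    rw [tendsto_zero_iff_abs_tendsto_zero]
    have := hsq.sqrt
    simpa [Real.sqrt_sq_eq_abs, Function.comp_def] using this
  choose y hy using exists_tendsto_of_weighted_abs (x := fun n => traj V x₀ n ω) hp hπp
    (fun n i => hx n ω i) hω1 hinc
  refine ⟨y, hy, fun i l hns => ?_⟩
  by_contra hne
  refine hns ?_
  have hd : 0 < (y i - y l) ^ 2 := by
    have := sub_ne_zero.2 hne
    positivity
  have hlim : Tendsto (fun n => (traj V x₀ n ω i - traj V x₀ n ω l) ^ 2) atTop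
      (𝓝 ((y i - y l) ^ 2)) := ((hy i).sub (hy l)).pow 2
  refine Summable.of_norm_bounded_eventually_nat
    ((hω2 i l).mul_left (2 / (y i - y l) ^ 2)) ?_
  filter_upwards [(tendsto_order.1 hlim).1 _ (half_lt_self hd)] with n hn
  rw [Real.norm_of_nonneg (hA0 n i l)]
  have h6 : 1 ≤ 2 / (y i - y l) ^ 2 * (traj V x₀ n ω i - traj V x₀ n ω l) ^ 2 := by
    rw [div_mul_eq_mul_div, le_div_iff₀ hd]
    linarith
  calc ∫ ω, V n ω i l ∂μ ≤ (∫ ω, V n ω i l ∂μ) *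
        (2 / (y i - y l) ^ 2 * (traj V x₀ n ω i - traj V x₀ n ω l) ^ 2) :=
        le_mul_of_one_le_right (hA0 n i l) h6
    _ = _ := by ring

end Trajectory

/-! ### Convergence and rank of the products -/

section Product

variable {m : ℕ} {Ω : Type*} {W : ℕ → Ω → Matrix (Fin m) (Fin m) ℝ}

open Classical in
/-- The matrices `W(t₀+1), W(t₀+2), …`, replaced by the identity on the null set where they fail to
be row-stochastic. -/
noncomputable def tail (W : ℕ → Ω → Matrix (Fin m) (Fin m) ℝ) (t₀ n : ℕ) (ω : Ω) :
    Matrix (Fin m) (Fin m) ℝ :=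
  if W (t₀ + n + 1) ω ∈ Matrix.rowStochastic ℝ (Fin m) then W (t₀ + n + 1) ω else 1

theorem tail_mem_rowStochastic (t₀ n : ℕ) (ω : Ω) :
    tail W t₀ n ω ∈ Matrix.rowStochastic ℝ (Fin m) := by
  unfold tail
  split_ifs with h
  · exact h
  · exact one_mem _

theorem traj_single_eq_prod {A : ℕ → Matrix (Fin m) (Fin m) ℝ} {t₀ : ℕ} {ω : Ω}
    {V : ℕ → Ω → Matrix (Fin m) (Fin m) ℝ} (h : ∀ n, V n ω = A (t₀ + n + 1)) (n : ℕ)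
    (i j : Fin m) : traj V (Pi.single j 1) n ω i = prod A (t₀ + n) t₀ i j := by
  have hvec : traj V (Pi.single j 1) n ω = (prod A (t₀ + n) t₀).mulVec (Pi.single j 1) := by
    induction n with
    | zero =>
      have h1 : prod A t₀ t₀ = 1 := by
        cases t₀ <;> simp [prod]
      rw [traj, add_zero, h1, Matrix.one_mulVec]
    | succ n ih =>
      rw [traj, ih, h, Matrix.mulVec_mulVec, ← add_assoc, prod, if_pos (Nat.le_add_right _ _)]
  rw [hvec, Matrix.mulVec_single_one]
  rfl

variable [MeasurableSpace Ω] {μ : Measure Ω}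

theorem cutFlow_integral {M : Ω → Matrix (Fin m) (Fin m) ℝ}
    (hM : ∀ i j, Integrable (fun ω => M ω i j) μ) (S : Finset (Fin m)) :
    ∫ ω, cutFlow (M ω) S ∂μ = cutFlow (Matrix.of fun i j => ∫ ω, M ω i j ∂μ) S := by
  unfold cutFlow
  rw [integral_finsetSum _ fun i _ => integrable_finsetSum _ fun j _ => hM i j]
  refine Finset.sum_congr rfl fun i _ => ?_
  rw [integral_finsetSum _ fun j _ => hM i j]
  rfl

/-- Strong aperiodicity bounds the diagonal of the expected matrices below: the diagonal entry
dominates `γ` times every other entry of its row, and the row sums to one. -/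
theorem le_integral_diag [IsProbabilityMeasure μ] {M : Ω → Matrix (Fin m) (Fin m) ℝ}
    (hM : ∀ i j, Measurable fun ω => M ω i j)
    (hst : ∀ ω, M ω ∈ Matrix.rowStochastic ℝ (Fin m)) {γ : ℝ} (hγ1 : γ ≤ 1)
    (hap : ∀ i j : Fin m, i ≠ j → γ * ∫ ω, M ω i j ∂μ ≤ ∫ ω, M ω i i * M ω i j ∂μ) (i : Fin m) :
    γ / (m + 1) ≤ ∫ ω, M ω i i ∂μ := by
  have h0 : ∀ ω i j, 0 ≤ M ω i j := fun ω i j => Matrix.nonneg_of_mem_rowStochastic (hst ω)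
  have h1 : ∀ ω i j, M ω i j ≤ 1 := fun ω i j => Matrix.le_one_of_mem_rowStochastic (hst ω)
  have hint : ∀ i j, Integrable (fun ω => M ω i j) μ := fun i j =>
    Integrable.of_mem_Icc 0 1 (hM i j).aemeasurable
      (Eventually.of_forall fun ω => ⟨h0 ω i j, h1 ω i j⟩)
  have hnn : 0 ≤ ∫ ω, M ω i i ∂μ := integral_nonneg fun ω => h0 ω i i
  have hle : ∀ j, γ * ∫ ω, M ω i j ∂μ ≤ ∫ ω, M ω i i ∂μ := by
    intro j
    by_cases h : i = j
    · subst h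
      exact mul_le_of_le_one_left hnn hγ1
    · refine (hap i j h).trans (integral_mono ?_ (hint i i) fun ω =>
        mul_le_of_le_one_right (h0 ω i i) (h1 ω i j))
      exact Integrable.of_mem_Icc 0 1 ((hM i i).mul (hM i j)).aemeasurable
        (Eventually.of_forall fun ω => ⟨mul_nonneg (h0 ω i i) (h0 ω i j),
          mul_le_one₀ (h1 ω i i) (h0 ω i j) (h1 ω i j)⟩)
  have hsum : ∑ j, ∫ ω, M ω i j ∂μ = 1 := by
    rw [← integral_finsetSum _ fun j _ => hint i j]
    simp [Matrix.sum_row_of_mem_rowStochastic (hst _)]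
  have h2 : γ ≤ m * ∫ ω, M ω i i ∂μ := by
    calc γ = ∑ j, γ * ∫ ω, M ω i j ∂μ := by rw [← Finset.mul_sum, hsum, mul_one]
      _ ≤ ∑ _j : Fin m, ∫ ω, M ω i i ∂μ := Finset.sum_le_sum fun j _ => hle j
      _ = m * ∫ ω, M ω i i ∂μ := by simp
  rw [div_le_iff₀ (by positivity)]
  linarith

theorem IsIndependentChain.tail_ae_eq (hW : IsIndependentChain μ W) (t₀ n : ℕ) :
    ∀ᵐ ω ∂μ, tail W t₀ n ω = W (t₀ + n + 1) ω := by
  filter_upwards [hW.stochastic (t₀ + n + 1) (by omega)] with ω hω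
  exact if_pos hω

open Classical in
theorem measurable_ite_rowStochastic :
    Measurable fun (M : Fin m → Fin m → ℝ) (i j : Fin m) =>
      (if Matrix.of M ∈ Matrix.rowStochastic ℝ (Fin m) then Matrix.of M else 1) i j := by
  have hset : MeasurableSet {M : Fin m → Fin m → ℝ |
      Matrix.of M ∈ Matrix.rowStochastic ℝ (Fin m)} := by
    simp only [Matrix.mem_rowStochastic_iff_sum, Matrix.of_apply]
    refine IsClosed.measurableSet ?_
    simp only [Set.ofPred_and, Set.ofPred_forall]
    refine IsClosed.inter ?_ ?_
    · exact isClosed_iInter fun i => isClosed_iInter fun j => isClosed_le (by fun_prop) (by fun_prop)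
    · exact isClosed_iInter fun i => isClosed_eq (by fun_prop) (by fun_prop)
  have h : Measurable fun M : Fin m → Fin m → ℝ =>
      if M ∈ {M : Fin m → Fin m → ℝ | Matrix.of M ∈ Matrix.rowStochastic ℝ (Fin m)} then M
      else fun i j => (1 : Matrix (Fin m) (Fin m) ℝ) i j :=
    Measurable.ite hset measurable_id measurable_const
  convert h using 1
  funext M i j
  simp only [Set.mem_ofPred_eq]
  split_ifs <;> rfl

theorem IsIndependentChain.measurable_tail (hW : IsIndependentChain μ W) (t₀ n : ℕ) :
    Measurable fun ω i j => tail W t₀ n ω i j :=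
  measurable_ite_rowStochastic.comp (measurable_pi_lambda _ fun i => measurable_pi_lambda _ fun j =>
    hW.measurable (t₀ + n + 1) (by omega) i j)

theorem IsIndependentChain.iIndepFun_tail (hW : IsIndependentChain μ W) (t₀ : ℕ) :
    iIndepFun (fun (n : ℕ) (ω : Ω) (i j : Fin m) => tail W t₀ n ω i j) μ :=
  (hW.indep.precomp (g := fun n => t₀ + n) (add_right_injective t₀)).comp _
    fun _ => measurable_ite_rowStochastic

theorem prod_mem_rowStochastic {A : ℕ → Matrix (Fin m) (Fin m) ℝ}
    (hA : ∀ n, 1 ≤ n → A n ∈ Matrix.rowStochastic ℝ (Fin m)) (k t₀ : ℕ) :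
    prod A k t₀ ∈ Matrix.rowStochastic ℝ (Fin m) := by
  induction k with
  | zero => exact one_mem _
  | succ k ih =>
    rw [prod]
    split_ifs
    · exact mul_mem (hA _ (by omega)) ih
    · exact one_mem _

theorem IsIndependentChain.measurable_prod (hW : IsIndependentChain μ W) (k t₀ : ℕ) (i j : Fin m) :
    Measurable fun ω => prod (fun n => W n ω) k t₀ i j := by
  induction k generalizing i j with
  | zero => exact measurable_const
  | succ k ih =>
    by_cases h : t₀ ≤ k
    · simp only [prod, if_pos h, Matrix.mul_apply]
      exact Finset.measurable_sum _ fun l _ => (hW.measurable (k + 1) (by omega) i l).mul (ih l j)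
    · simp only [prod, if_neg h]
      exact measurable_const

theorem sum_Icc_one_eq_sum_range (f : ℕ → ℝ) (n : ℕ) :
    ∑ k ∈ Finset.Icc 1 n, f k = ∑ k ∈ Finset.range n, f (k + 1) := by
  induction n with
  | zero => simp
  | succ n ih => rw [Finset.sum_Icc_succ_top (by omega), ih, Finset.sum_range_succ]

/-- Adjacency in the flow graph passes to every tail of the chain, in one of the two directions. -/
theorem not_summable_of_flowGraph_adj {A : ℕ → Matrix (Fin m) (Fin m) ℝ} {i j : Fin m}
    (h : (flowGraph A).Adj i j) (t₀ : ℕ) :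
    (¬ Summable fun n => A (t₀ + n + 1) i j) ∨ ¬ Summable fun n => A (t₀ + n + 1) j i := by
  by_contra! hs
  have h1 : Summable fun n => A (n + 1) i j + A (n + 1) j i := by
    rw [← summable_nat_add_iff t₀]
    refine (hs.1.add hs.2).congr fun n => ?_
    rw [add_comm n t₀]
  have h2 := h.2
  simp only [sum_Icc_one_eq_sum_range] at h2
  exact not_tendsto_atTop_of_tendsto_nhds h1.hasSum.tendsto_sum_nat h2

theorem IsIndependentChain.integrable [IsProbabilityMeasure μ] (hW : IsIndependentChain μ W)
    {k : ℕ} (hk : 1 ≤ k) (i j : Fin m) : Integrable (fun ω => W k ω i j) μ := by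
  refine Integrable.of_mem_Icc 0 1 (hW.measurable k hk i j).aemeasurable ?_
  filter_upwards [hW.stochastic k hk] with ω hω
  exact ⟨Matrix.nonneg_of_mem_rowStochastic hω, Matrix.le_one_of_mem_rowStochastic hω⟩

/-- Almost surely, the flow graph of the sample path is a subgraph of the flow graph of the expected
chain: a series of nonnegative variables with summable expectations converges almost surely. -/
theorem IsIndependentChain.ae_flowGraph_le [IsProbabilityMeasure μ] (hW : IsIndependentChain μ W) :
    ∀ᵐ ω ∂μ, (flowGraph fun k => W k ω) ≤ flowGraph (expected μ W) := by
  have h0 : ∀ k, 1 ≤ k → ∀ i j, 0 ≤ᵐ[μ] fun ω => W k ω i j := by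
    intro k hk i j
    filter_upwards [hW.stochastic k hk] with ω hω
    exact Matrix.nonneg_of_mem_rowStochastic hω
  have key : ∀ᵐ ω ∂μ, ∀ i j,
      (flowGraph fun k => W k ω).Adj i j → (flowGraph (expected μ W)).Adj i j := by
    refine ae_all_iff.2 fun i => ae_all_iff.2 fun j => ?_
    by_cases hadj : (flowGraph (expected μ W)).Adj i j
    · exact Eventually.of_forall fun _ _ => hadj
    by_cases hij : i = j
    · exact Eventually.of_forall fun _ h => absurd hij h.1
    have hsum : Summable fun n => ∫ ω, (W (n + 1) ω i j + W (n + 1) ω j i) ∂μ := by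
      by_contra hns
      rw [not_summable_iff_tendsto_nat_atTop_of_nonneg fun n => integral_nonneg_of_ae (by
        filter_upwards [h0 (n + 1) (by omega) i j, h0 (n + 1) (by omega) j i] with ω h1 h2
        exact add_nonneg h1 h2)] at hns
      refine hadj ⟨hij, hns.congr fun n => ?_⟩
      rw [sum_Icc_one_eq_sum_range]
      refine Finset.sum_congr rfl fun k _ => ?_
      exact integral_add (hW.integrable (by omega) i j) (hW.integrable (by omega) j i)
    have hae := ae_summable_of_summable_integral
      (fun n => (hW.integrable (k := n + 1) (by omega) i j).add (hW.integrable (by omega) j i))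
      (fun n => by
        filter_upwards [h0 (n + 1) (by omega) i j, h0 (n + 1) (by omega) j i] with ω h1 h2
        exact add_nonneg h1 h2) hsum
    filter_upwards [hae] with ω hω hadjω
    have h2 := hadjω.2
    simp only [sum_Icc_one_eq_sum_range] at h2
    exact absurd h2 (not_tendsto_atTop_of_tendsto_nhds hω.hasSum.tendsto_sum_nat)
  filter_upwards [key] with ω hω i j h
  exact hω i j h

/-- A matrix whose rows agree along the edges of a graph factors through the components of the
graph. -/
theorem rank_le_card_connectedComponent (G : SimpleGraph (Fin m)) {L : Matrix (Fin m) (Fin m) ℝ}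
    (h : ∀ i j, G.Adj i j → L i = L j) : L.rank ≤ Nat.card G.ConnectedComponent := by
  classical
  have hwalk : ∀ i j, G.Walk i j → L i = L j := by
    intro i j w
    induction w with
    | nil => rfl
    | cons hadj _ ih => exact (h _ _ hadj).trans ih
  have : Fintype G.ConnectedComponent := Fintype.ofFinite _
  let row : G.ConnectedComponent → Fin m → ℝ :=
    SimpleGraph.ConnectedComponent.lift L fun i j w _ => hwalk i j w
  let P : Matrix (Fin m) G.ConnectedComponent ℝ :=
    Matrix.of fun i c => if G.connectedComponentMk i = c then 1 else 0
  have hL : L = P * Matrix.of row := by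
    ext i j
    simp only [P, Matrix.mul_apply, Matrix.of_apply, ite_mul, one_mul, zero_mul,
      Finset.sum_ite_eq, Finset.mem_univ, if_true]
    rfl
  rw [Nat.card_eq_fintype_card]
  calc L.rank = (P * Matrix.of row).rank := congrArg Matrix.rank hL
    _ ≤ (Matrix.of row).rank := Matrix.rank_mul_le_right _ _
    _ ≤ _ := Matrix.rank_le_card_height _

theorem rank_pos_of_mem_rowStochastic [Nonempty (Fin m)] {L : Matrix (Fin m) (Fin m) ℝ}
    (hL : L ∈ Matrix.rowStochastic ℝ (Fin m)) : 0 < L.rank := by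
  rw [Nat.pos_iff_ne_zero]
  intro h
  rw [Matrix.rank, Module.finrank_eq_zero_iff_of_free, Submodule.subsingleton_iff_eq_bot,
    LinearMap.range_eq_bot] at h
  have h1 : L.mulVec 1 = 0 := by
    rw [← Matrix.mulVecLin_apply, h, LinearMap.zero_apply]
  rw [Matrix.one_vecMul_of_mem_rowStochastic hL] at h1
  exact one_ne_zero h1

/-- Almost surely the products converge to a row-stochastic matrix whose rows agree along the edges
of the flow graph of the expected chain. -/
theorem IsIndependentChain.exists_limit [IsProbabilityMeasure μ] (hW : IsIndependentChain μ W)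
    (hbal : Balanced μ W) (hap : StronglyAperiodic μ W) (t₀ : ℕ) :
    ∃ L : Ω → Matrix (Fin m) (Fin m) ℝ, (∀ i j, Measurable fun ω => L ω i j) ∧
      ∀ᵐ ω ∂μ, L ω ∈ Matrix.rowStochastic ℝ (Fin m) ∧
        (∀ i j, (flowGraph (expected μ W)).Adj i j → L ω i = L ω j) ∧
        Tendsto (fun k => prod (fun n => W n ω) k t₀) atTop (𝓝 (L ω)) := by
  obtain ⟨γ, hγ, hγ1, hap⟩ := hap
  obtain ⟨α, hα, hbal⟩ := hbal
  set V := tail W t₀ with hV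
  have hmeas := hW.measurable_tail t₀
  have hst : ∀ n ω, V n ω ∈ Matrix.rowStochastic ℝ (Fin m) := tail_mem_rowStochastic t₀
  have hind := hW.iIndepFun_tail t₀
  have hVij : ∀ n i j, Measurable fun ω => V n ω i j := fun n i j =>
    (measurable_pi_apply j).comp ((measurable_pi_apply i).comp (hmeas n))
  have hint : ∀ n i j, Integrable (fun ω => V n ω i j) μ := fun n i j =>
    Integrable.of_mem_Icc 0 1 (hVij n i j).aemeasurable (Eventually.of_forall fun ω =>
      ⟨Matrix.nonneg_of_mem_rowStochastic (hst n ω), Matrix.le_one_of_mem_rowStochastic (hst n ω)⟩)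
  have hae := hW.tail_ae_eq t₀
  have hEV : ∀ n i j, ∫ ω, V n ω i j ∂μ = expected μ W (t₀ + n + 1) i j := fun n i j =>
    integral_congr_ae ((hae n).mono fun ω h => by simp only [hV, h])
  have hapV : ∀ n, ∀ i j : Fin m, i ≠ j →
      γ * ∫ ω, V n ω i j ∂μ ≤ ∫ ω, V n ω i i * V n ω i j ∂μ := by
    intro n i j hij
    have h1 : ∫ ω, V n ω i i * V n ω i j ∂μ =
        ∫ ω, W (t₀ + n + 1) ω i i * W (t₀ + n + 1) ω i j ∂μ :=
      integral_congr_ae ((hae n).mono fun ω h => by simp only [hV, h])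
    rw [h1, hEV]
    exact hap (t₀ + n + 1) (by omega) i j hij
  set A : ℕ → Matrix (Fin m) (Fin m) ℝ := fun n => Matrix.of fun i j => ∫ ω, V n ω i j ∂μ with hA
  have hAst : ∀ n, A n ∈ Matrix.rowStochastic ℝ (Fin m) := by
    intro n
    rw [Matrix.mem_rowStochastic_iff_sum]
    refine ⟨fun i j => integral_nonneg fun ω => Matrix.nonneg_of_mem_rowStochastic (hst n ω),
      fun i => ?_⟩
    simp only [hA, Matrix.of_apply]
    rw [← integral_finsetSum _ fun j _ => hint n i j]
    simp [Matrix.sum_row_of_mem_rowStochastic (hst n _)]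
  have hbalA : ∀ n, ∀ S : Finset (Fin m), S.Nonempty → S ≠ Finset.univ →
      α * cutFlow (A n) Sᶜ ≤ cutFlow (A n) S := by
    intro n S hS hS'
    have hAn : A n = Matrix.of fun i j => ∫ ω, W (t₀ + n + 1) ω i j ∂μ := by
      ext i j
      exact hEV n i j
    have h1 := hbal (t₀ + n + 1) (by omega) S hS hS'
    rwa [cutFlow_integral (fun i j => hW.integrable (by omega) i j),
      cutFlow_integral (fun i j => hW.integrable (by omega) i j), ← hAn] at h1
  obtain ⟨p, hp, π, hπp, hπB, hπ⟩ := exists_absolute_weights hAst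
    (div_pos hγ (by positivity : (0 : ℝ) < m + 1))
    (fun n i => le_integral_diag (hVij n) (hst n) hγ1 (hapV n) i) hα hbalA
  have hconv : ∀ᵐ ω ∂μ, ∀ j, ∃ y : Fin m → ℝ,
      (∀ i, Tendsto (fun n => traj V (Pi.single j 1) n ω i) atTop (𝓝 (y i))) ∧
      ∀ i l, (¬ Summable fun n => ∫ ω, V n ω i l ∂μ) → y i = y l := by
    refine ae_all_iff.2 fun j => ae_tendsto_traj hmeas hst hind hγ hapV hp hπp hπB hπ fun i => ?_
    by_cases h : i = j
    · subst h
      simp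
    · simp [h]
  have hlim : ∀ᵐ ω ∂μ, ∃ M : Matrix (Fin m) (Fin m) ℝ,
      M ∈ Matrix.rowStochastic ℝ (Fin m) ∧
      (∀ i j, (flowGraph (expected μ W)).Adj i j → M i = M j) ∧
      ∀ i j, Tendsto (fun k => prod (fun n => W n ω) k t₀ i j) atTop (𝓝 (M i j)) := by
    have hstW : ∀ᵐ ω ∂μ, ∀ n, 1 ≤ n → W n ω ∈ Matrix.rowStochastic ℝ (Fin m) :=
      ae_all_iff.2 fun n => by
        by_cases hn : 1 ≤ n
        · filter_upwards [hW.stochastic n hn] with ω hω _ using hω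
        · exact Eventually.of_forall fun _ h => absurd h hn
    filter_upwards [hconv, ae_all_iff.2 hae, hstW] with ω hω hVW hWst
    choose y hy hyeq using hω
    have htend : ∀ i j, Tendsto (fun k => prod (fun n => W n ω) k t₀ i j) atTop (𝓝 (y j i)) := by
      intro i j
      rw [← tendsto_add_atTop_iff_nat t₀]
      refine (hy j i).congr fun n => ?_
      rw [traj_single_eq_prod (A := fun n => W n ω) hVW, add_comm]
    refine ⟨Matrix.of fun i j => y j i, ?_, ?_, htend⟩
    · rw [Matrix.mem_rowStochastic_iff_sum]
      refine ⟨fun i j => ge_of_tendsto' (htend i j) fun k =>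
        Matrix.nonneg_of_mem_rowStochastic (prod_mem_rowStochastic hWst k t₀), fun i => ?_⟩
      refine tendsto_nhds_unique (tendsto_finsetSum Finset.univ fun j _ => htend i j) ?_
      simp only [Matrix.sum_row_of_mem_rowStochastic (prod_mem_rowStochastic hWst _ t₀)]
      exact tendsto_const_nhds
    · intro i j hadj
      funext l
      rcases not_summable_of_flowGraph_adj hadj t₀ with h | h
      · exact hyeq l i j (by simpa only [hEV] using h)
      · exact (hyeq l j i (by simpa only [hEV] using h)).symm
  have hentry : ∀ i j, ∃ f : Ω → ℝ, Measurable f ∧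
      ∀ᵐ ω ∂μ, Tendsto (fun k => prod (fun n => W n ω) k t₀ i j) atTop (𝓝 (f ω)) := fun i j =>
    measurable_limit_of_tendsto_metrizable_ae
      (fun k => (hW.measurable_prod k t₀ i j).aemeasurable)
      (hlim.mono fun ω ⟨M, _, _, hM⟩ => ⟨M i j, hM i j⟩)
  choose f hf hft using hentry
  refine ⟨fun ω => Matrix.of fun i j => f i j ω, hf, ?_⟩
  filter_upwards [hlim, ae_all_iff.2 fun i => ae_all_iff.2 fun j => hft i j]
    with ω ⟨M, hMst, hMrow, hM⟩ hfω
  have hfM : (Matrix.of fun i j => f i j ω) = M := by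
    ext i j
    exact tendsto_nhds_unique (hfω i j) (hM i j)
  rw [hfM]
  exact ⟨hMst, hMrow, tendsto_pi_nhds.2 fun i => tendsto_pi_nhds.2 fun j => hM i j⟩

end Product

end StochasticChain

theorem mainTheorem8 {m : ℕ} {Ω : Type*} [MeasurableSpace Ω] (μ : Measure Ω)
    [IsProbabilityMeasure μ] (W : ℕ → Ω → Matrix (Fin m) (Fin m) ℝ)
    (hW : StochasticChain.IsIndependentChain μ W)
    (hbal : StochasticChain.Balanced μ W)
    (hap : StochasticChain.StronglyAperiodic μ W) :
    ((∀ᵐ ω ∂μ, (StochasticChain.flowGraph fun k => W k ω).Connected) →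
      ∀ t₀ : ℕ, ∃ L : Ω → Matrix (Fin m) (Fin m) ℝ,
        (∀ i j, Measurable fun ω => L ω i j) ∧
        ∀ᵐ ω ∂μ, L ω ∈ Matrix.rowStochastic ℝ (Fin m) ∧ (L ω).rank = 1 ∧
          Tendsto (fun k => StochasticChain.prod (fun n => W n ω) k t₀) atTop (𝓝 (L ω))) ∧
    (∀ t₀ : ℕ, ∃ L : Ω → Matrix (Fin m) (Fin m) ℝ,
        (∀ i j, Measurable fun ω => L ω i j) ∧
        ∀ᵐ ω ∂μ,
          (L ω).rank ≤ Nat.card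
            (StochasticChain.flowGraph (StochasticChain.expected μ W)).ConnectedComponent ∧
          Tendsto (fun k => StochasticChain.prod (fun n => W n ω) k t₀) atTop (𝓝 (L ω))) := by
  constructor
  · intro hconn t₀
    obtain ⟨ω₀, hω₀, hle⟩ := (hconn.and hW.ae_flowGraph_le).exists
    have hG := hω₀.mono hle
    have : Nonempty (Fin m) := hG.nonempty
    have hcard : Nat.card
        (StochasticChain.flowGraph (StochasticChain.expected μ W)).ConnectedComponent = 1 := by
      have := hG.preconnected.subsingleton_connectedComponent
      exact Nat.card_eq_one_iff_unique.2 ⟨this, inferInstance⟩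
    obtain ⟨L, hL, hlim⟩ := hW.exists_limit hbal hap t₀
    refine ⟨L, hL, hlim.mono fun ω ⟨hst, hrow, ht⟩ => ⟨hst, le_antisymm ?_ ?_, ht⟩⟩
    · exact (StochasticChain.rank_le_card_connectedComponent _ hrow).trans_eq hcard
    · exact StochasticChain.rank_pos_of_mem_rowStochastic hst
  · intro t₀
    obtain ⟨L, hL, hlim⟩ := hW.exists_limit hbal hap t₀
    exact ⟨L, hL, hlim.mono fun ω ⟨_, hrow, ht⟩ =>
      ⟨StochasticChain.rank_le_card_connectedComponent _ hrow, ht⟩⟩
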